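/- Let $d,n\ge 1$, let $x_1,\dots,x_n\in\mathbb R^d$ be observations (not necessarily distinct), and let $\mathbb P_n=\frac1n\sum_{i=1}^n\delta_{\{x_i\}}$ be their empirical law. For a probability law $\mathbb P$ on $\mathbb R^d$, $\delta>0$ and $z\in\mathbb R^d$ let $$D_\delta(z\mid\mathbb P)=\inf_{\|u\|=1}\ \sup_{\mathbb P':\,d_W(\mathbb P',\mathbb P)\le\delta}\mathbb P'\big(\{y:\langle u,y-z\rangle\ge 0\}\big)$$ be the robustified halfspace depth, where $\|\cdot\|$ is the Euclidean norm, $\mathbb P'$ runs over probability laws on $\mathbb R^d$, and $d_W(\mathbb P,\mathbb P')=\inf_\Pi\int\|x-y\|\,\Pi(dx,dy)\in[0,\infty]$, the infimum being over all joint laws $\Pi$ with marginals $\mathbb P$ and $\mathbb P'$. Let $\overline\alpha(\delta)=\sup_{z}D_\delta(z\mid\mathbb P_n)$ be the maximal depth and $M_\delta=\{z\in\mathbb R^d:D_\delta(z\mid\mathbb P_n)=\overline\alpha(\delta)\}$ the median region. For nonempty $I\subseteq\{1,\dots,n\}$ let $B_I$ be the closed ball with center $\frac1{|I|}\sum_{i\in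 I}x_i$ and radius $\delta n/|I|$. Let $\mathcal C$ be the class of all $I\subseteq\{1,\dots,n\}$ such that $\{x_i:i\in I\}$ and $\{x_i:i\notin I\}$ lie strictly on opposite sides of some hyperplane (if one of these sets is empty, this only means that some hyperplane has all the observations strictly on one side, which always holds). (a) For every $\delta>0$ with $\overline\alpha(\delta)=1$, $$M_\delta=\bigcap_{I\in\mathcal C,\ I\ne\emptyset}B_I=\bigcap_{I\ne\emptyset}B_I .$$ (b) There is $\delta_0>0$, depending on $x_1,\dots,x_n$, such that for every $\delta\ge\delta_0$ the set $M_\delta$ is the closed ball of radius $\delta$ centered at the sample mean $\frac1n\sum_{i=1}^n x_i$. -/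

import Mathlib

open MeasureTheory
open scoped ENNReal RealInnerProductSpace

namespace RobustDepth

noncomputable section

/-- The Wasserstein distance of order one (Euclidean cost) between two laws on `ℝ^d`: the infimum
of `∫ ‖x - y‖ dπ(x, y)` over all joint laws `π` with the given marginals, with values in `[0, ∞]`
(it is `∞` when no joint law has finite cost). -/
def wassersteinDist {d : ℕ} (P Q : Measure (EuclideanSpace ℝ (Fin d))) : ℝ≥0∞ :=
  ⨅ (π : Measure (EuclideanSpace ℝ (Fin d) × EuclideanSpace ℝ (Fin d)))
    (_ : π.fst = P ∧ π.snd = Q), ∫⁻ p, ‖p.1 - p.2‖ₑ ∂π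

/-- The ambiguity set: all probability laws within Wasserstein distance `δ` of `P`. -/
def ambiguitySet {d : ℕ} (δ : ℝ) (P : Measure (EuclideanSpace ℝ (Fin d))) :
    Set (Measure (EuclideanSpace ℝ (Fin d))) :=
  {Q | IsProbabilityMeasure Q ∧ wassersteinDist Q P ≤ ENNReal.ofReal δ}

/-- The robustified halfspace depth of `z` for the law `P` and the ambiguity radius `δ`: the
infimum over unit directions `u` of the worst-case mass of the closed halfspace
`{y | ⟪u, y - z⟫ ≥ 0}`. -/
def robustDepth {d : ℕ} (δ : ℝ) (P : Measure (EuclideanSpace ℝ (Fin d)))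
    (z : EuclideanSpace ℝ (Fin d)) : ℝ≥0∞ :=
  ⨅ (u : EuclideanSpace ℝ (Fin d)) (_ : ‖u‖ = 1), ⨆ Q ∈ ambiguitySet δ P, Q {y | 0 ≤ ⟪u, y - z⟫}

/-- The maximal depth. -/
def maxDepth {d : ℕ} (δ : ℝ) (P : Measure (EuclideanSpace ℝ (Fin d))) : ℝ≥0∞ :=
  ⨆ z, robustDepth δ P z

/-- The median region: the points of maximal depth. -/
def medianRegion {d : ℕ} (δ : ℝ) (P : Measure (EuclideanSpace ℝ (Fin d))) :
    Set (EuclideanSpace ℝ (Fin d)) :=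
  {z | robustDepth δ P z = maxDepth δ P}

/-- The empirical law of the observations `x 0, …, x (n - 1)`. -/
def empiricalMeasure {d n : ℕ} (x : Fin n → EuclideanSpace ℝ (Fin d)) :
    Measure (EuclideanSpace ℝ (Fin d)) :=
  (n : ℝ≥0∞)⁻¹ • ∑ i, Measure.dirac (x i)

/-- The index sets `I` such that some hyperplane `{y | ⟪u, y⟫ = c}` has the observations with index
in `I` strictly on one side and the remaining observations strictly on the other side. -/
def separableSets {d n : ℕ} (x : Fin n → EuclideanSpace ℝ (Fin d)) : Set (Finset (Fin n)) :=
  {I | ∃ (u : EuclideanSpace ℝ (Fin d)) (c : ℝ), u ≠ 0 ∧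
    (∀ i ∈ I, c < ⟪u, x i⟫) ∧ (∀ i ∉ I, ⟪u, x i⟫ < c)}

/-- The closed ball centered at the mean of the observations with index in `I`, with radius
`δ n / |I|`. -/
def subsetBall {d n : ℕ} (x : Fin n → EuclideanSpace ℝ (Fin d)) (δ : ℝ) (I : Finset (Fin n)) :
    Set (EuclideanSpace ℝ (Fin d)) :=
  Metric.closedBall ((I.card : ℝ)⁻¹ • ∑ i ∈ I, x i) (δ * (n : ℝ) / (I.card : ℝ))

end

end RobustDepth

/-! Orthogonal projection is the cheapest way to move mass into a halfspace. Hence the worst-case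
mass of `{y | 0 ≤ ⟪u, y - z⟫}` is one exactly when the sum of the positive parts of `⟪u, z - x i⟫`
is at most `δ * n` (`one_le_iSup_halfspace_iff`). That sum is the maximum over `I` of `⟪u, ∑ i ∈ I,
(z - x i)⟫`. Maximizing over unit `u` turns it into a norm, and bounding this norm by `δ * n` is
membership in `subsetBall x δ I`. For given `u` the maximizing `I` is cut off by a hyperplane, so
separable sets suffice. For large `δ` the gap between `δ * n / |I|` and `δ` exceeds the distance
between the centers, so the ball of the full sample lies in all the others; being nonempty, it
forces maximal depth one. -/

namespace RobustDepth

section Transport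

variable {d : ℕ}

/-- A bounded truncation of the distance to a halfspace integrates to at most the transport cost
plus the mass left outside the halfspace. -/
theorem lintegral_min_le_wassersteinDist_add (P Q : Measure (EuclideanSpace ℝ (Fin d)))
    (z u : EuclideanSpace ℝ (Fin d)) (hu : ‖u‖ = 1) (M : ℝ≥0∞) :
    ∫⁻ y, min (ENNReal.ofReal ⟪u, z - y⟫) M ∂P ≤
      wassersteinDist Q P + M * Q {y | 0 ≤ ⟪u, y - z⟫}ᶜ := by
  have hH : MeasurableSet {y : EuclideanSpace ℝ (Fin d) | 0 ≤ ⟪u, y - z⟫} :=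
    measurableSet_le measurable_const (by fun_prop)
  unfold wassersteinDist
  simp only [ENNReal.iInf_add]
  refine le_iInf fun π => le_iInf fun hπ => ?_
  obtain ⟨rfl, rfl⟩ := hπ
  rw [Measure.snd, lintegral_map (by fun_prop) measurable_snd, Measure.fst,
    Measure.map_apply measurable_fst hH.compl,
    ← lintegral_indicator_const (measurable_fst hH.compl), ← lintegral_add_left (by fun_prop)]
  refine lintegral_mono fun p => ?_
  -- Pointwise in the coupling: mass ending inside the halfspace pays its distance to it, mass
  -- ending outside is charged `M`.
  by_cases hp : 0 ≤ ⟪u, p.1 - z⟫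
  · refine (min_le_left _ _).trans (le_add_right ?_)
    rw [← ofReal_norm]
    refine ENNReal.ofReal_le_ofReal ?_
    have h : ⟪u, z - p.2⟫ + ⟪u, p.1 - z⟫ = ⟪u, p.1 - p.2⟫ := by
      rw [← inner_add_right]; congr 1; abel
    have h' := real_inner_le_norm u (p.1 - p.2)
    rw [hu, one_mul] at h'
    linarith
  · refine (min_le_right _ _).trans (le_add_left ?_)
    simp [Set.indicator, hp]

/-- Projecting a law onto a halfspace costs at most the mean distance to the halfspace. -/
theorem exists_mem_ambiguitySet_halfspace_eq_one (δ : ℝ)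
    (P : Measure (EuclideanSpace ℝ (Fin d))) [IsProbabilityMeasure P]
    (z u : EuclideanSpace ℝ (Fin d)) (hu : ‖u‖ = 1)
    (h : ∫⁻ y, ENNReal.ofReal ⟪u, z - y⟫ ∂P ≤ ENNReal.ofReal δ) :
    ∃ Q ∈ ambiguitySet δ P, Q {y | 0 ≤ ⟪u, y - z⟫} = 1 := by
  let T : EuclideanSpace ℝ (Fin d) → EuclideanSpace ℝ (Fin d) :=
    fun y => y + max ⟪u, z - y⟫ 0 • u
  have hT : Measurable T := by fun_prop
  have hH : MeasurableSet {y : EuclideanSpace ℝ (Fin d) | 0 ≤ ⟪u, y - z⟫} :=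
    measurableSet_le measurable_const (by fun_prop)
  have hpair : Measurable fun y => (T y, y) := hT.prodMk measurable_id
  refine ⟨P.map T, ⟨Measure.isProbabilityMeasure_map hT.aemeasurable, ?_⟩, ?_⟩
  · have hfst : (P.map fun y => (T y, y)).fst = P.map T := by
      rw [Measure.fst, Measure.map_map measurable_fst hpair]; rfl
    have hsnd : (P.map fun y => (T y, y)).snd = P := by
      rw [Measure.snd, Measure.map_map measurable_snd hpair]; exact Measure.map_id
    refine (iInf₂_le (P.map fun y => (T y, y)) ⟨hfst, hsnd⟩).trans ?_
    rw [lintegral_map (by fun_prop) hpair]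
    refine le_trans (lintegral_mono fun y => ?_) h
    simp only [T, add_sub_cancel_left]
    rw [← ofReal_norm, norm_smul, hu, mul_one, Real.norm_of_nonneg (le_max_right _ _)]
    rcases le_total ⟪u, z - y⟫ 0 with h0 | h0 <;> simp [h0]
  · rw [Measure.map_apply hT hH]
    convert measure_univ (μ := P)
    refine Set.eq_univ_of_forall fun y => ?_
    have h1 : ⟪u, T y - z⟫ = max ⟪u, z - y⟫ 0 - ⟪u, z - y⟫ := by
      simp only [T, inner_sub_right, inner_add_right, inner_smul_right,
        real_inner_self_eq_norm_sq, hu]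
      ring
    change 0 ≤ ⟪u, T y - z⟫
    rw [h1]
    exact sub_nonneg.2 (le_max_left _ _)

end Transport

section Depth

variable {d n : ℕ}

theorem lintegral_empiricalMeasure (x : Fin n → EuclideanSpace ℝ (Fin d))
    (f : EuclideanSpace ℝ (Fin d) → ℝ≥0∞) :
    ∫⁻ y, f y ∂(empiricalMeasure x) = (n : ℝ≥0∞)⁻¹ * ∑ i, f (x i) := by
  simp [empiricalMeasure]

theorem isProbabilityMeasure_empiricalMeasure (hn : 1 ≤ n)
    (x : Fin n → EuclideanSpace ℝ (Fin d)) : IsProbabilityMeasure (empiricalMeasure x) := by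
  constructor
  have h := lintegral_empiricalMeasure x 1
  simp only [Pi.one_apply, lintegral_one, Finset.sum_const, Finset.card_univ, Fintype.card_fin,
    nsmul_eq_mul, mul_one] at h
  rw [h, ENNReal.inv_mul_cancel (by simp; omega) (by simp)]

theorem exists_norm_eq_one (hd : 1 ≤ d) : ∃ u : EuclideanSpace ℝ (Fin d), ‖u‖ = 1 :=
  ⟨EuclideanSpace.single ⟨0, hd⟩ 1, by simp⟩

theorem robustDepth_le_one (hd : 1 ≤ d) (δ : ℝ) (P : Measure (EuclideanSpace ℝ (Fin d)))
    (z : EuclideanSpace ℝ (Fin d)) : robustDepth δ P z ≤ 1 := by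
  obtain ⟨u, hu⟩ := exists_norm_eq_one hd
  refine (iInf₂_le u hu).trans (iSup₂_le fun Q hQ => ?_)
  have := hQ.1
  exact prob_le_one

/-- The forward direction does not assume that the supremum is attained: truncation gives a bound
linear in the halfspace mass of `Q`, which passes to the supremum. -/
theorem one_le_iSup_halfspace_iff (hn : 1 ≤ n) (x : Fin n → EuclideanSpace ℝ (Fin d)) (δ : ℝ)
    (z u : EuclideanSpace ℝ (Fin d)) (hu : ‖u‖ = 1) :
    1 ≤ ⨆ Q ∈ ambiguitySet δ (empiricalMeasure x), Q {y | 0 ≤ ⟪u, y - z⟫} ↔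
      ∫⁻ y, ENNReal.ofReal ⟪u, z - y⟫ ∂(empiricalMeasure x) ≤ ENNReal.ofReal δ := by
  have := isProbabilityMeasure_empiricalMeasure hn x
  constructor
  · intro h
    -- Large enough that truncating at `M` changes nothing at the observations, yet finite, so that
    -- it cancels at the end.
    set M : ℝ≥0∞ := ∑ i, ENNReal.ofReal ⟪u, z - x i⟫ with hM
    have hMtop : M ≠ ∞ := ENNReal.sum_ne_top.2 fun i _ => ENNReal.ofReal_ne_top
    set J : ℝ≥0∞ := ∫⁻ y, ENNReal.ofReal ⟪u, z - y⟫ ∂(empiricalMeasure x) with hJ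
    have hJmin : ∫⁻ y, min (ENNReal.ofReal ⟪u, z - y⟫) M ∂(empiricalMeasure x) = J := by
      rw [hJ, lintegral_empiricalMeasure, lintegral_empiricalMeasure]
      congr 1
      refine Finset.sum_congr rfl fun i hi => min_eq_left ?_
      exact Finset.single_le_sum (f := fun i => ENNReal.ofReal ⟪u, z - x i⟫)
        (fun _ _ => zero_le) hi
    have hJtop : J ≠ ∞ := by
      rw [hJ, lintegral_empiricalMeasure]
      exact ENNReal.mul_ne_top (by simp; omega) hMtop
    have hQ : ∀ Q ∈ ambiguitySet δ (empiricalMeasure x),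
        M * Q {y | 0 ≤ ⟪u, y - z⟫} ≤ ENNReal.ofReal δ + M - J := by
      rintro Q ⟨hQ1, hQ2⟩
      refine ENNReal.le_sub_of_add_le_right hJtop ?_
      have h1 := lintegral_min_le_wassersteinDist_add (empiricalMeasure x) Q z u hu M
      rw [hJmin] at h1
      have hH : MeasurableSet {y : EuclideanSpace ℝ (Fin d) | 0 ≤ ⟪u, y - z⟫} :=
        measurableSet_le measurable_const (by fun_prop)
      have h2 := prob_add_prob_compl (μ := Q) hH
      calc M * Q {y | 0 ≤ ⟪u, y - z⟫} + J
          ≤ M * Q {y | 0 ≤ ⟪u, y - z⟫} +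
              (ENNReal.ofReal δ + M * Q {y | 0 ≤ ⟪u, y - z⟫}ᶜ) := by
            gcongr; exact h1.trans (by gcongr)
        _ = ENNReal.ofReal δ +
              M * (Q {y | 0 ≤ ⟪u, y - z⟫} + Q {y | 0 ≤ ⟪u, y - z⟫}ᶜ) := by ring
        _ = ENNReal.ofReal δ + M := by rw [h2, mul_one]
    have h3 : M ≤ ENNReal.ofReal δ + M - J :=
      calc M ≤ M * ⨆ Q ∈ ambiguitySet δ (empiricalMeasure x), Q {y | 0 ≤ ⟪u, y - z⟫} :=
            le_mul_of_one_le_right' h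
        _ ≤ _ := by
            simp only [ENNReal.mul_iSup]
            exact iSup₂_le hQ
    have hJle : J ≤ ENNReal.ofReal δ + M := by
      have : J ≤ M := by
        rw [hJ, lintegral_empiricalMeasure]
        refine mul_le_of_le_one_left' ?_
        rw [ENNReal.inv_le_one]
        exact_mod_cast hn
      exact this.trans le_add_self
    have h4 : M + J ≤ M + ENNReal.ofReal δ := by
      calc M + J ≤ (ENNReal.ofReal δ + M - J) + J := by gcongr
        _ = M + ENNReal.ofReal δ := by rw [tsub_add_cancel_of_le hJle, add_comm]
    exact (ENNReal.add_le_add_iff_left hMtop).1 h4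
  · intro h
    obtain ⟨Q, hQ, hQ1⟩ :=
      exists_mem_ambiguitySet_halfspace_eq_one δ (empiricalMeasure x) z u hu h
    exact hQ1.symm.le.trans (le_iSup₂ (f := fun Q _ => Q {y | 0 ≤ ⟪u, y - z⟫}) Q hQ)

theorem lintegral_halfspace_le_iff (hn : 1 ≤ n) (x : Fin n → EuclideanSpace ℝ (Fin d)) {δ : ℝ}
    (hδ : 0 < δ) (z u : EuclideanSpace ℝ (Fin d)) :
    ∫⁻ y, ENNReal.ofReal ⟪u, z - y⟫ ∂(empiricalMeasure x) ≤ ENNReal.ofReal δ ↔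
      ∑ i, max ⟪u, z - x i⟫ 0 ≤ δ * n := by
  have hn0 : (n : ℝ≥0∞) ≠ 0 := by simp; omega
  have hsum : ∑ i, ENNReal.ofReal ⟪u, z - x i⟫ =
      ENNReal.ofReal (∑ i, max ⟪u, z - x i⟫ 0) := by
    rw [ENNReal.ofReal_sum_of_nonneg fun i _ => le_max_right _ _]
    refine Finset.sum_congr rfl fun i _ => ?_
    rcases le_total ⟪u, z - x i⟫ 0 with h0 | h0 <;> simp [h0]
  rw [lintegral_empiricalMeasure, hsum, ENNReal.inv_mul_le_iff hn0 (by simp),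
    ← ENNReal.ofReal_natCast, ← ENNReal.ofReal_mul (by positivity),
    ENNReal.ofReal_le_ofReal_iff (by positivity), mul_comm]

theorem robustDepth_eq_one_iff (hd : 1 ≤ d) (hn : 1 ≤ n) (x : Fin n → EuclideanSpace ℝ (Fin d))
    {δ : ℝ} (hδ : 0 < δ) (z : EuclideanSpace ℝ (Fin d)) :
    robustDepth δ (empiricalMeasure x) z = 1 ↔
      ∀ u : EuclideanSpace ℝ (Fin d), ‖u‖ = 1 → ∑ i, max ⟪u, z - x i⟫ 0 ≤ δ * n := by
  rw [← (robustDepth_le_one hd δ _ z).ge_iff_eq, robustDepth, le_iInf₂_iff]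
  refine forall₂_congr fun u hu => ?_
  rw [one_le_iSup_halfspace_iff hn x δ z u hu, lintegral_halfspace_le_iff hn x hδ]

end Depth

section Balls

variable {d n : ℕ}

theorem mem_subsetBall_iff (x : Fin n → EuclideanSpace ℝ (Fin d)) (δ : ℝ) {I : Finset (Fin n)}
    (hI : I.Nonempty) (z : EuclideanSpace ℝ (Fin d)) :
    z ∈ subsetBall x δ I ↔ ‖∑ i ∈ I, (z - x i)‖ ≤ δ * n := by
  have hc : (0 : ℝ) < I.card := by exact_mod_cast hI.card_pos
  have h : ∑ i ∈ I, (z - x i) = (I.card : ℝ) • (z - (I.card : ℝ)⁻¹ • ∑ i ∈ I, x i) := by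
    rw [Finset.sum_sub_distrib, Finset.sum_const, smul_sub, smul_inv_smul₀ hc.ne',
      Nat.cast_smul_eq_nsmul]
  rw [subsetBall, mem_closedBall_iff_norm, h, norm_smul, Real.norm_of_nonneg hc.le,
    le_div_iff₀ hc, mul_comm]

theorem filter_inner_pos_mem_separableSets (x : Fin n → EuclideanSpace ℝ (Fin d))
    (z u : EuclideanSpace ℝ (Fin d)) (hu : u ≠ 0) :
    (Finset.univ.filter fun i => 0 < ⟪u, z - x i⟫) ∈ separableSets x := by
  set I := Finset.univ.filter fun i => 0 < ⟪u, z - x i⟫ with hI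
  have hmem : ∀ i, i ∈ I ↔ ⟪u, x i⟫ < ⟪u, z⟫ := fun i => by simp [hI, inner_sub_right]
  -- Observations outside `I` may lie on the hyperplane through `z`; since `I` is finite, a slight
  -- shift makes both sides strict.
  obtain ⟨c, hc, hcI⟩ : ∃ c, c < ⟪u, z⟫ ∧ ∀ i ∈ I, ⟪u, x i⟫ < c := by
    have h : ∀ᶠ c in nhdsWithin ⟪u, z⟫ (Set.Iio ⟪u, z⟫),
        c < ⟪u, z⟫ ∧ ∀ i ∈ I, ⟪u, x i⟫ < c := by
      refine Filter.Eventually.and self_mem_nhdsWithin ?_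
      rw [Filter.eventually_all_finset]
      exact fun i hi => nhdsWithin_le_nhds (eventually_gt_nhds ((hmem i).1 hi))
    exact h.exists
  refine ⟨-u, -c, neg_ne_zero.2 hu, fun i hi => ?_, fun i hi => ?_⟩
  · rw [inner_neg_left]; exact neg_lt_neg (hcI i hi)
  · rw [inner_neg_left]
    rw [hmem, not_lt] at hi
    exact neg_lt_neg (hc.trans_le hi)

theorem sum_max_le_of_mem_subsetBall (x : Fin n → EuclideanSpace ℝ (Fin d)) {δ : ℝ} (hδ : 0 < δ)
    (z : EuclideanSpace ℝ (Fin d))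
    (h : ∀ I : Finset (Fin n), I ∈ separableSets x → I.Nonempty → z ∈ subsetBall x δ I)
    (u : EuclideanSpace ℝ (Fin d)) (hu : ‖u‖ = 1) :
    ∑ i, max ⟪u, z - x i⟫ 0 ≤ δ * n := by
  set I := Finset.univ.filter fun i => 0 < ⟪u, z - x i⟫ with hI
  have hsum : ∑ i, max ⟪u, z - x i⟫ 0 = ∑ i ∈ I, ⟪u, z - x i⟫ := by
    rw [hI, Finset.sum_filter]
    refine Finset.sum_congr rfl fun i _ => ?_
    split_ifs with h0
    · exact max_eq_left h0.le
    · exact max_eq_right (not_lt.1 h0)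
  rcases I.eq_empty_or_nonempty with hempty | hne
  · rw [hsum, hempty, Finset.sum_empty]; positivity
  · have hu0 : u ≠ 0 := fun h0 => by simp [h0] at hu
    have hb := (mem_subsetBall_iff x δ hne z).1
      (h I (filter_inner_pos_mem_separableSets x z u hu0) hne)
    rw [hsum, ← inner_sum]
    refine (real_inner_le_norm _ _).trans ?_
    rwa [hu, one_mul]

theorem mem_subsetBall_of_sum_max_le (x : Fin n → EuclideanSpace ℝ (Fin d)) {δ : ℝ} (hδ : 0 < δ)
    (z : EuclideanSpace ℝ (Fin d))
    (h : ∀ u : EuclideanSpace ℝ (Fin d), ‖u‖ = 1 → ∑ i, max ⟪u, z - x i⟫ 0 ≤ δ * n)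
    {I : Finset (Fin n)} (hI : I.Nonempty) : z ∈ subsetBall x δ I := by
  rw [mem_subsetBall_iff x δ hI]
  set v := ∑ i ∈ I, (z - x i) with hv
  rcases eq_or_ne v 0 with h0 | h0
  · rw [h0, norm_zero]; positivity
  have hpos : ‖v‖ ≠ 0 := norm_ne_zero_iff.2 h0
  -- The direction for which Cauchy–Schwarz is an equality.
  set u := ‖v‖⁻¹ • v with hu
  have hu1 : ‖u‖ = 1 := by
    rw [hu, norm_smul, norm_inv, norm_norm, inv_mul_cancel₀ hpos]
  calc ‖v‖ = ⟪u, v⟫ := by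
        rw [hu, real_inner_smul_left, real_inner_self_eq_norm_sq]; field_simp
    _ = ∑ i ∈ I, ⟪u, z - x i⟫ := by rw [hv, inner_sum]
    _ ≤ ∑ i ∈ I, max ⟪u, z - x i⟫ 0 := Finset.sum_le_sum fun i _ => le_max_left _ _
    _ ≤ ∑ i, max ⟪u, z - x i⟫ 0 :=
        Finset.sum_le_univ_sum_of_nonneg fun i => le_max_right _ _
    _ ≤ δ * n := h u hu1

theorem robustDepth_eq_one_iff_separable (hd : 1 ≤ d) (hn : 1 ≤ n)
    (x : Fin n → EuclideanSpace ℝ (Fin d)) {δ : ℝ} (hδ : 0 < δ)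
    (z : EuclideanSpace ℝ (Fin d)) :
    robustDepth δ (empiricalMeasure x) z = 1 ↔
      ∀ I : Finset (Fin n), I ∈ separableSets x → I.Nonempty → z ∈ subsetBall x δ I := by
  rw [robustDepth_eq_one_iff hd hn x hδ]
  exact ⟨fun h I _ hI => mem_subsetBall_of_sum_max_le x hδ z h hI,
    sum_max_le_of_mem_subsetBall x hδ z⟩

theorem robustDepth_eq_one_iff_nonempty (hd : 1 ≤ d) (hn : 1 ≤ n)
    (x : Fin n → EuclideanSpace ℝ (Fin d)) {δ : ℝ} (hδ : 0 < δ)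
    (z : EuclideanSpace ℝ (Fin d)) :
    robustDepth δ (empiricalMeasure x) z = 1 ↔
      ∀ I : Finset (Fin n), I.Nonempty → z ∈ subsetBall x δ I := by
  rw [robustDepth_eq_one_iff hd hn x hδ]
  exact ⟨fun h I hI => mem_subsetBall_of_sum_max_le x hδ z h hI,
    fun h => sum_max_le_of_mem_subsetBall x hδ z fun I _ => h I⟩

theorem subsetBall_univ (hn : 1 ≤ n) (x : Fin n → EuclideanSpace ℝ (Fin d)) (δ : ℝ) :
    subsetBall x δ Finset.univ = Metric.closedBall ((n : ℝ)⁻¹ • ∑ i, x i) δ := by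
  have hn0 : (n : ℝ) ≠ 0 := by positivity
  simp [subsetBall, hn0]

/-- For a large radius, the ball of the full sample is contained in all other balls. -/
theorem exists_closedBall_mean_subset_subsetBall (hn : 1 ≤ n)
    (x : Fin n → EuclideanSpace ℝ (Fin d)) :
    ∃ δ₀ : ℝ, 0 < δ₀ ∧ ∀ δ : ℝ, δ₀ ≤ δ → ∀ I : Finset (Fin n), I.Nonempty →
      Metric.closedBall ((n : ℝ)⁻¹ • ∑ i, x i) δ ⊆ subsetBall x δ I := by
  set r : Finset (Fin n) → ℝ := fun I =>
    (n : ℝ) * dist ((n : ℝ)⁻¹ • ∑ i, x i) ((I.card : ℝ)⁻¹ • ∑ i ∈ I, x i) with hr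
  have hr0 : ∀ I, 0 ≤ r I := fun I => by positivity
  -- The sum dominates every `r I` at once; the `1` ensures positivity.
  refine ⟨1 + ∑ I, r I, add_pos_of_pos_of_nonneg one_pos (Finset.sum_nonneg fun I _ => hr0 I),
    fun δ hδ I hI => ?_⟩
  rcases eq_or_ne I Finset.univ with rfl | hne
  · rw [subsetBall_univ hn]
  have hrI : r I ≤ δ := by
    have := Finset.single_le_sum (fun J _ => hr0 J) (Finset.mem_univ I)
    linarith
  have hδ0 : 0 ≤ δ := (hr0 I).trans hrI
  have hc : (0 : ℝ) < I.card := by exact_mod_cast hI.card_pos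
  have hcn : (I.card : ℝ) + 1 ≤ n := by
    have := Finset.card_lt_card (Finset.ssubset_univ_iff.2 hne)
    rw [Finset.card_univ, Fintype.card_fin] at this
    exact_mod_cast this
  refine Metric.closedBall_subset_closedBall' ?_
  rw [le_div_iff₀ hc]
  have hD : 0 ≤ dist ((n : ℝ)⁻¹ • ∑ i, x i) ((I.card : ℝ)⁻¹ • ∑ i ∈ I, x i) := dist_nonneg
  simp only [hr] at hrI
  -- With `D` the distance between the centers, `D * |I| ≤ n * D ≤ δ ≤ δ * (n - |I|)`.
  nlinarith

end Balls

end RobustDepth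

theorem mainTheorem10 {d n : ℕ} (hd : 1 ≤ d) (hn : 1 ≤ n)
    (x : Fin n → EuclideanSpace ℝ (Fin d)) :
    (∀ δ : ℝ, 0 < δ →
      RobustDepth.maxDepth δ (RobustDepth.empiricalMeasure x) = 1 →
        RobustDepth.medianRegion δ (RobustDepth.empiricalMeasure x) =
            ⋂ I ∈ {I : Finset (Fin n) | I ∈ RobustDepth.separableSets x ∧ I.Nonempty},
              RobustDepth.subsetBall x δ I ∧
        RobustDepth.medianRegion δ (RobustDepth.empiricalMeasure x) =
            ⋂ I ∈ {I : Finset (Fin n) | I.Nonempty}, RobustDepth.subsetBall x δ I) ∧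
    (∃ δ₀ : ℝ, 0 < δ₀ ∧ ∀ δ : ℝ, δ₀ ≤ δ →
      RobustDepth.medianRegion δ (RobustDepth.empiricalMeasure x) =
        Metric.closedBall ((n : ℝ)⁻¹ • ∑ i, x i) δ) := by
  have hmed : ∀ δ : ℝ, RobustDepth.maxDepth δ (RobustDepth.empiricalMeasure x) = 1 → ∀ z,
      z ∈ RobustDepth.medianRegion δ (RobustDepth.empiricalMeasure x) ↔
        RobustDepth.robustDepth δ (RobustDepth.empiricalMeasure x) z = 1 := fun δ h z => by
    rw [RobustDepth.medianRegion, Set.mem_ofPred_eq, h]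
  refine ⟨fun δ hδ h => ⟨?_, ?_⟩, ?_⟩
  · ext z
    rw [hmed δ h, RobustDepth.robustDepth_eq_one_iff_separable hd hn x hδ]
    simp only [Set.mem_iInter, Set.mem_ofPred_eq, and_imp]
  · ext z
    rw [hmed δ h, RobustDepth.robustDepth_eq_one_iff_nonempty hd hn x hδ]
    simp only [Set.mem_iInter, Set.mem_ofPred_eq]
  · obtain ⟨δ₀, hδ₀, hsub⟩ := RobustDepth.exists_closedBall_mean_subset_subsetBall hn x
    refine ⟨δ₀, hδ₀, fun δ hδ => ?_⟩
    have hpos : 0 < δ := hδ₀.trans_le hδ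
    have hball : ∀ z, RobustDepth.robustDepth δ (RobustDepth.empiricalMeasure x) z = 1 ↔
        z ∈ Metric.closedBall ((n : ℝ)⁻¹ • ∑ i, x i) δ := fun z => by
      rw [RobustDepth.robustDepth_eq_one_iff_nonempty hd hn x hpos]
      refine ⟨fun h => ?_, fun h I hI => hsub δ hδ I hI h⟩
      rw [← RobustDepth.subsetBall_univ hn]
      exact h Finset.univ ⟨⟨0, hn⟩, Finset.mem_univ _⟩
    have hmax : RobustDepth.maxDepth δ (RobustDepth.empiricalMeasure x) = 1 := by
      refine le_antisymm (iSup_le fun z => RobustDepth.robustDepth_le_one hd δ _ z) ?_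
      rw [← (hball _).2 (Metric.mem_closedBall_self hpos.le)]
      exact le_iSup (RobustDepth.robustDepth δ (RobustDepth.empiricalMeasure x)) _
    ext z
    rw [hmed δ hmax, hball]
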